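/- **Notation.** For $q_1,\dots,q_n\in\mathbb H$ and $K=\{k_1<\dots<k_p\}\subset\{1,\dots,n\}$ put $q_K=q_{k_1}\cdots q_{k_p}$ ($q_\emptyset=1$); products $\prod_{i\in K}$ of quaternions are taken in increasing order of the index. A *stem function* on $\mathbb C^n$ is a family $F=(F_K)_{K\subset\{1,\dots,n\}}$ (written $F=\sum_Ke_KF_K$) of functions $F_K:\mathbb C^n\to\mathbb H$ such that, for every $h$, conjugating $z_h$ multiplies $F_K(z)$ by $-1$ if $h\in K$ and leaves it unchanged otherwise. It induces the *slice function* $\mathcal I(F):\mathbb H^n\to\mathbb H$, $$\mathcal I(F)(\alpha_1+J_1\beta_1,\dots,\alpha_n+J_n\beta_n)=\sum_K J_K\,F_K(\alpha_1+i\beta_1,\dots,\alpha_n+i\beta_n),\qquad \alpha_h,\beta_h\in\mathbb R,\ J_h\in\mathbb H,\ J_h^2=-1,$$ which determines $F$. The slice product is $\mathcal I(F)\odot\mathcal I(G)=\mathcal I(F\otimes G)$ with $F\otimes G=\sum_{K,L}(-1)^{|K\cap L|}e_{K\triangle L}F_KG_L$. For $f=\mathcal I(F)$ and $H=\{h_1<\dots<h_p\}$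 the spherical derivative is $f'_{s,H}=\mathcal I\big((\cdots(F'_{h_1})'_{h_2}\cdots)'_{h_p}\big)$, where $F'_h(z)=\sum_{K\not\ni h}e_K(\operatorname{Im}z_h)^{-1}F_{K\cup\{h\}}(z)$; it is defined on $\Omega_H=\{x\in\mathbb H^n: x_h\notin\mathbb R\ \forall h\in H\}$. For $K\subset H$ the Almansi component of $f$ is $\mathcal S^H_K(f)=(x_K\odot f)'_{s,H}$. Identify $\mathbb H$ with $\mathbb R^4$ through the coordinates with respect to $1,i,j,k$. For $k\ge0$ let $\mathcal Z_k(\cdot,1)$ be the zonal harmonic of $\mathbb R^4$ of degree $k$ with pole $1$, i.e. the real harmonic homogeneous polynomial of degree $k$ such that $p(1)=\int_{S^3}p(\zeta)\,\mathcal Z_k(\zeta,1)\,d\sigma(\zeta)$ for every real harmonic homogeneous polynomial $p$ of degree $k$, $\sigma$ being the normalized surface measure. Put $\tilde{\mathcal Z}_k(x)=\mathcal Z_k(x,1)/(k+1)$ for $k\ge0$ and $\tilde{\mathcal Z}_{-1}=0$. Let $\chi_K$ be the characteristic function of $K$. **Proposition.** Let $P(x)=\sum_\alpha x_1^{\alpha_1}\cdots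 x_n^{\alpha_n}a_\alpha$ (a finite sum over multi-indices $\alpha\in\mathbb N^n$, $a_\alpha\in\mathbb H$) be a quaternionic polynomial function on $\mathbb H^n$ with right coefficients. Then $P$ is a slice function, and for all $K\subset H\subset\{1,\dots,n\}$ $$\mathcal S^H_K(P)(x)=\sum_\alpha\ \prod_{j\in H}\tilde{\mathcal Z}_{\alpha_j-1+\chi_K(j)}(x_j)\ \prod_{i\notin H}x_i^{\alpha_i}\ a_\alpha\qquad\text{for every }x\in\Omega_H .$$ Moreover, at every $x\in\mathbb H^n$ the right-hand side is the limit of $\mathcal S^H_K(P)(y)$ as $y\to x$, $y\in\Omega_H$; thus $\mathcal S^H_K(P)$ extends continuously to $\mathbb H^n$ and the formula holds on all of $\mathbb H^n$. -/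

import Mathlib

open scoped Quaternion BigOperators
open MeasureTheory

noncomputable section

namespace Almansi

/-! ### Stem functions and slice functions of `n` quaternionic variables

All functions below have domain `D = ℂⁿ`, whose circularization is `ℍⁿ`. -/

variable {n : ℕ}

/-- The ordered product `q_{k₁} ⋯ q_{k_p}` for `K = {k₁ < ⋯ < k_p}` (equal to `1` if `K = ∅`). -/
def ordProd (K : Finset (Fin n)) (q : Fin n → ℍ[ℝ]) : ℍ[ℝ] :=
  ((K.sort (· ≤ ·)).map q).prod

/-- Functions `F = ∑_K e_K F_K : ℂⁿ → ℍ ⊗ ℝ^{2ⁿ}`; the value `F z K` is the component `F_K(z)`. -/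
abbrev StemFun (n : ℕ) : Type := (Fin n → ℂ) → Finset (Fin n) → ℍ[ℝ]

/-- `z̄^h`: the `h`-th coordinate of `z` is conjugated. -/
def conjAt (h : Fin n) (z : Fin n → ℂ) : Fin n → ℂ :=
  Function.update z h (starRingEnd ℂ (z h))

/-- `F` is a stem function: `F_K(z̄^h) = (-1)^{|K ∩ {h}|} F_K(z)`. -/
def IsStem (F : StemFun n) : Prop :=
  ∀ (z : Fin n → ℂ) (h : Fin n) (K : Finset (Fin n)),
    F (conjAt h z) K = (-1) ^ (K ∩ {h}).card * F z K

/-- For `q ∈ ℍ ∖ ℝ` this is the `J` with `q = α + J β`, `β > 0`, `J² = -1`. For real `q` every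
`J` with `J² = -1` is admissible and, for stem functions, immaterial; the value here is `0`. -/
def imUnit (q : ℍ[ℝ]) : ℍ[ℝ] := ‖q.im‖⁻¹ • q.im

/-- `α + i β` for `q = α + J β`, `β ≥ 0`. -/
def toC (q : ℍ[ℝ]) : ℂ := ⟨q.re, ‖q.im‖⟩

/-- The function `𝓘(F) : ℍⁿ → ℍ` induced by `F`, that is `x ↦ ∑_K [J_K, F_K(z)]`. The theorem
`slice_apply` shows that for a stem function any representation `x_h = α_h + J_h β_h` can be
used. -/
def slice (F : StemFun n) (x : Fin n → ℍ[ℝ]) : ℍ[ℝ] :=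
  ∑ K : Finset (Fin n), ordProd K (fun h => imUnit (x h)) * F (fun h => toC (x h)) K

/-- `f` is a slice function on `ℍⁿ`. -/
def IsSlice (f : (Fin n → ℍ[ℝ]) → ℍ[ℝ]) : Prop :=
  ∃ F : StemFun n, IsStem F ∧ slice F = f

open Classical in
/-- `𝓘⁻¹(f)`, the stem function inducing a slice function `f`; it is unique by
`IsStem.eq_of_slice_eq`. (Junk value `0` if `f` is not a slice function.) -/
def stemOf (f : (Fin n → ℍ[ℝ]) → ℍ[ℝ]) : StemFun n :=
  if hf : IsSlice f then Classical.choose hf else 0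

/-- The product `F ⊗ G = ∑_{K, L} (-1)^{|K ∩ L|} e_{K Δ L} F_K G_L`. -/
def stemMul (F G : StemFun n) : StemFun n := fun z T =>
  ∑ K : Finset (Fin n), ∑ L : Finset (Fin n),
    if symmDiff K L = T then (-1) ^ (K ∩ L).card * (F z K * G z L) else 0

/-- The slice product `f ⊙ g = 𝓘(F ⊗ G)`. -/
def sliceMul (f g : (Fin n → ℍ[ℝ]) → ℍ[ℝ]) : (Fin n → ℍ[ℝ]) → ℍ[ℝ] :=
  slice (stemMul (stemOf f) (stemOf g))

/-- `F'_h = ∑_{K ∌ h} e_K β_h⁻¹ F_{K ∪ {h}}`, where `β_h = Im z_h`; only the values at points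
with `β_h ≠ 0` are meaningful. -/
def stemDeriv (h : Fin n) (F : StemFun n) : StemFun n := fun z K =>
  if h ∈ K then 0 else (z h).im⁻¹ • F z (insert h K)

/-- `F'_H = (⋯(F'_{h₁})'_{h₂}⋯)'_{h_p}` for `H = {h₁ < ⋯ < h_p}`. -/
def stemDerivSet (H : Finset (Fin n)) (F : StemFun n) : StemFun n :=
  (H.sort (· ≤ ·)).foldl (fun G h => stemDeriv h G) F

/-- The iterated spherical derivative `f'_{s,H} = 𝓘(F'_H)`, a function on `offReal H`. -/
def sphericalDeriv (H : Finset (Fin n)) (f : (Fin n → ℍ[ℝ]) → ℍ[ℝ]) :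
    (Fin n → ℍ[ℝ]) → ℍ[ℝ] :=
  slice (stemDerivSet H (stemOf f))

/-- The points `x ∈ ℍⁿ` with `x_h ∉ ℝ` for every `h ∈ H`. -/
def offReal (H : Finset (Fin n)) : Set (Fin n → ℍ[ℝ]) :=
  {x | ∀ h ∈ H, (x h).im ≠ 0}

/-- The Almansi component `𝓢^H_K(f) = (x_K ⊙ f)'_{s,H}`, a function on `offReal H`. -/
def component (H K : Finset (Fin n)) (f : (Fin n → ℍ[ℝ]) → ℍ[ℝ]) : (Fin n → ℍ[ℝ]) → ℍ[ℝ] :=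
  sphericalDeriv H (sliceMul (fun x => ordProd K x) f)

/-! ### Polynomials with right coefficients -/

/-- The function `x ↦ ∑_α x₁^{α₁} ⋯ x_n^{α_n} a_α`, for finitely many nonzero `a_α`. -/
def polyFun (a : (Fin n → ℕ) →₀ ℍ[ℝ]) (x : Fin n → ℍ[ℝ]) : ℍ[ℝ] :=
  ∑ α ∈ a.support, ordProd Finset.univ (fun i => x i ^ α i) * a α

/-! ### Zonal harmonics of `ℝ⁴` -/

/-- Real homogeneous harmonic polynomials of degree `k` on `ℝ⁴`. -/
def IsSolidHarmonic (k : ℕ) (p : MvPolynomial (Fin 4) ℝ) : Prop :=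
  p.IsHomogeneous k ∧ ∑ i : Fin 4, MvPolynomial.pderiv i (MvPolynomial.pderiv i p) = 0

/-- `Z` is the zonal harmonic of degree `k` with pole `η ∈ S³`: it is a homogeneous harmonic
polynomial of degree `k`, and integration against it over `S³`, with respect to the normalized
surface measure, reproduces the value at `η` of every homogeneous harmonic polynomial of
degree `k`. -/
def IsZonalHarmonic (k : ℕ) (η : EuclideanSpace ℝ (Fin 4)) (Z : MvPolynomial (Fin 4) ℝ) : Prop :=
  IsSolidHarmonic k Z ∧
    ∀ p : MvPolynomial (Fin 4) ℝ, IsSolidHarmonic k p →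
      MvPolynomial.eval (fun i => η i) p =
        ⨍ ζ : Metric.sphere (0 : EuclideanSpace ℝ (Fin 4)) 1,
          MvPolynomial.eval (fun i => (ζ : EuclideanSpace ℝ (Fin 4)) i) p *
            MvPolynomial.eval (fun i => (ζ : EuclideanSpace ℝ (Fin 4)) i) Z
          ∂((volume : Measure (EuclideanSpace ℝ (Fin 4))).toSphere)

open Classical in
/-- The zonal harmonic `𝓩_k(·, η)` as a polynomial on `ℝ⁴`. -/
def zonalPoly (k : ℕ) (η : EuclideanSpace ℝ (Fin 4)) : MvPolynomial (Fin 4) ℝ :=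
  if h : ∃ Z, IsZonalHarmonic k η Z then Classical.choose h else 0

/-- `𝓩_k(x, y)` for `x ∈ ℍ` and `y ∈ ℍ` of norm `1`, where `ℍ` is identified with `ℝ⁴` through
the coordinates with respect to `1, i, j, k`. -/
def zonal (k : ℕ) (x y : ℍ[ℝ]) : ℝ :=
  MvPolynomial.eval (fun i => Quaternion.linearIsometryEquivTuple x i)
    (zonalPoly k (Quaternion.linearIsometryEquivTuple y))

/-- `𝓩̃_k(x) = 𝓩_k(x, 1) / (k + 1)` for `k ≥ 0`, and `0` for `k = -1`. -/
def zonalTilde : ℤ → ℍ[ℝ] → ℝ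
  | Int.ofNat k, x => zonal k x 1 / ((k : ℝ) + 1)
  | Int.negSucc _, _ => 0

/-! ### The induced function does not depend on the representation of the point, and the stem
function is determined by the induced function -/

theorem IsStem.conj_set {F : StemFun n} (hF : IsStem F) (z : Fin n → ℂ) (K N : Finset (Fin n)) :
    F (fun h => if h ∈ N then starRingEnd ℂ (z h) else z h) K
      = (-1) ^ (K ∩ N).card * F z K := by
  induction N using Finset.induction_on with
  | empty => simp
  | insert a N ha ih =>
    have h1 : (fun h => if h ∈ insert a N then starRingEnd ℂ (z h) else z h)
        = conjAt a (fun h => if h ∈ N then starRingEnd ℂ (z h) else z h) := by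
      funext h
      by_cases hh : h = a
      · subst hh; simp [conjAt, ha]
      · simp [conjAt, hh]
    have h2 : (K ∩ insert a N).card = (K ∩ {a}).card + (K ∩ N).card := by
      rw [← Finset.card_union_of_disjoint]
      · congr 1
        ext h; simp only [Finset.mem_inter, Finset.mem_insert, Finset.mem_union,
          Finset.mem_singleton]; tauto
      · rw [Finset.disjoint_left]
        intro h h3 h4
        simp only [Finset.mem_inter, Finset.mem_singleton] at h3 h4
        exact ha (h3.2 ▸ h4.2)
    rw [h1, hF, ih, h2, pow_add, mul_assoc]

theorem IsStem.eq_zero {F : StemFun n} (hF : IsStem F) (z : Fin n → ℂ) (K : Finset (Fin n))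
    (h : Fin n) (hK : h ∈ K) (hz : (z h).im = 0) : F z K = 0 := by
  have h1 : conjAt h z = z := by
    rw [conjAt, Complex.conj_eq_iff_im.2 hz, Function.update_eq_self]
  have h2 := hF z h K
  rw [h1, Finset.inter_singleton_of_mem hK] at h2
  have h3 : (2 : ℝ) • F z K = 0 := by
    rw [two_smul]
    nth_rewrite 1 [h2]
    simp
  simpa using h3

theorem ordProd_smul (K : Finset (Fin n)) (s : Fin n → ℝ) (q : Fin n → ℍ[ℝ]) :
    ordProd K (fun h => s h • q h) = (∏ h ∈ K, s h) • ordProd K q := by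
  have key : ∀ l : List (Fin n), (l.map (fun h => s h • q h)).prod
      = (l.map s).prod • (l.map q).prod := by
    intro l
    induction l with
    | nil => simp
    | cons a l ih => simp [ih, smul_smul, mul_comm]
  have h2 : ((K.sort (· ≤ ·)).map s).prod = ∏ h ∈ K, s h := by
    conv_rhs => rw [← Finset.sort_toFinset K (· ≤ ·)]
    rw [List.prod_toFinset _ (Finset.sort_nodup K _)]
  rw [ordProd, key, h2, ordProd]

theorem slice_apply {F : StemFun n} (hF : IsStem F) (z : Fin n → ℂ) (J : Fin n → ℍ[ℝ])
    (hJ : ∀ h, J h * J h = -1) :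
    slice F (fun h => ((z h).re : ℍ[ℝ]) + J h * ((z h).im : ℍ[ℝ]))
      = ∑ K : Finset (Fin n), ordProd K J * F z K := by
  have hJ2 : ∀ h, (J h).re = 0 ∧ ‖J h‖ = 1 := by
    intro h
    have hn : ‖J h‖ = 1 := by
      have := congrArg norm (hJ h)
      rw [norm_mul, norm_neg, norm_one] at this
      nlinarith [norm_nonneg (J h)]
    refine ⟨Quaternion.sq_eq_neg_normSq.1 ?_, hn⟩
    rw [sq, hJ h, Quaternion.normSq_eq_norm_mul_self, hn]; simp
  have him : ∀ h, (((z h).re : ℍ[ℝ]) + J h * ((z h).im : ℍ[ℝ])).im = (z h).im • J h := by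
    intro h
    have := (hJ2 h).1
    ext <;> simp [this, mul_comm]
  have hre : ∀ h, (((z h).re : ℍ[ℝ]) + J h * ((z h).im : ℍ[ℝ])).re = (z h).re := by
    intro h
    simp [(hJ2 h).1]
  have hC : (fun h => toC (((z h).re : ℍ[ℝ]) + J h * ((z h).im : ℍ[ℝ])))
      = fun h => if h ∈ Finset.univ.filter (fun h => (z h).im < 0)
          then starRingEnd ℂ (z h) else z h := by
    funext h
    rw [toC, him, hre, norm_smul, (hJ2 h).2]
    by_cases hs : (z h).im < 0
    · simp [hs, Complex.ext_iff, abs_of_neg hs]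
    · simp [hs, abs_of_nonneg (not_lt.1 hs)]
  have hU : (fun h => imUnit (((z h).re : ℍ[ℝ]) + J h * ((z h).im : ℍ[ℝ])))
      = fun h => (|(z h).im|⁻¹ * (z h).im) • J h := by
    funext h
    rw [imUnit, him, norm_smul, (hJ2 h).2, smul_smul, mul_one, Real.norm_eq_abs]
  unfold slice
  refine Finset.sum_congr rfl fun K _ => ?_
  rw [hC, hU, hF.conj_set, ordProd_smul]
  by_cases h0 : ∃ h ∈ K, (z h).im = 0
  · obtain ⟨h, hK, hz⟩ := h0
    simp [hF.eq_zero z K h hK hz]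
  · push Not at h0
    have : (∏ h ∈ K, (|(z h).im|⁻¹ * (z h).im))
        = (-1) ^ (K ∩ Finset.univ.filter (fun h => (z h).im < 0)).card := by
      rw [← Finset.prod_const, ← Finset.filter_mem_eq_inter, Finset.prod_filter]
      refine Finset.prod_congr rfl fun h hh => ?_
      have := h0 h hh
      by_cases hs : (z h).im < 0
      · simp [hs, abs_of_neg hs, inv_neg, this]
      · simp [hs, abs_of_nonneg (not_lt.1 hs), this]
    rw [this]
    rcases Nat.even_or_odd (K ∩ Finset.univ.filter (fun h => (z h).im < 0)).card with h | h
    · simp [h.neg_one_pow]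
    · simp [h.neg_one_pow]

theorem sum_sign_eq_zero (c : Finset (Fin n) → ℍ[ℝ])
    (hc : ∀ N : Finset (Fin n), ∑ K : Finset (Fin n), ((-1 : ℝ) ^ (K ∩ N).card) • c K = 0)
    (T : Finset (Fin n)) : c T = 0 := by
  have card_eq : ∀ K N : Finset (Fin n),
      ((-1 : ℝ) ^ (K ∩ N).card) = ∏ h ∈ N, (if h ∈ K then (-1 : ℝ) else 1) := by
    intro K N
    rw [Finset.inter_comm, ← Finset.prod_const, ← Finset.filter_mem_eq_inter, Finset.prod_filter]
  have orth : ∀ K : Finset (Fin n),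
      ∑ N : Finset (Fin n), ((-1 : ℝ) ^ (T ∩ N).card) * ((-1 : ℝ) ^ (K ∩ N).card)
        = if K = T then 2 ^ n else 0 := by
    intro K
    have h1 : ∀ N : Finset (Fin n), ((-1 : ℝ) ^ (T ∩ N).card) * ((-1 : ℝ) ^ (K ∩ N).card)
        = ∏ h ∈ N, ((if h ∈ T then (-1 : ℝ) else 1) * (if h ∈ K then (-1 : ℝ) else 1)) := by
      intro N
      rw [card_eq, card_eq, Finset.prod_mul_distrib]
    simp_rw [h1]
    rw [← Finset.powerset_univ, ← Finset.prod_one_add]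
    by_cases hKT : K = T
    · subst hKT
      rw [if_pos rfl, Finset.prod_congr rfl (g := fun _ => (2 : ℝ))]
      · simp
      · intro h _
        by_cases hh : h ∈ K <;> simp [hh] <;> norm_num
    · rw [if_neg hKT]
      have : ∃ h, ¬ (h ∈ K ↔ h ∈ T) := by
        by_contra hcon
        push Not at hcon
        exact hKT (Finset.ext hcon)
      obtain ⟨h, hh⟩ := this
      refine Finset.prod_eq_zero (Finset.mem_univ h) ?_
      by_cases h1 : h ∈ K <;> by_cases h2 : h ∈ T <;> simp [h1, h2] at hh ⊢
  have h3 : ∑ N : Finset (Fin n), ((-1 : ℝ) ^ (T ∩ N).card) •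
      ∑ K : Finset (Fin n), ((-1 : ℝ) ^ (K ∩ N).card) • c K = 0 := by
    simp [hc]
  simp_rw [Finset.smul_sum, smul_smul] at h3
  rw [Finset.sum_comm] at h3
  simp_rw [← Finset.sum_smul, orth] at h3
  simpa using h3

theorem IsStem.eq_of_slice_eq {F G : StemFun n} (hF : IsStem F) (hG : IsStem G)
    (h : slice F = slice G) : F = G := by
  let J : Fin n → ℍ[ℝ] := fun _ => ⟨0, 1, 0, 0⟩
  have hJ : ∀ h, J h * J h = -1 := by
    intro h
    have h1 := QuaternionAlgebra.mk_mul_mk (c₁ := (-1 : ℝ)) (c₂ := (0 : ℝ)) (c₃ := (-1 : ℝ))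
      0 1 0 0 0 1 0 0
    refine h1.trans ?_
    ext <;> simp
  have hJ0 : ∀ K, ordProd K J ≠ 0 := by
    intro K
    rw [ordProd, ne_eq, List.prod_eq_zero_iff]
    simp only [List.mem_map, not_exists, not_and]
    intro h _ h0
    have := hJ h
    rw [h0] at this
    simp at this
  funext z T
  have key := sum_sign_eq_zero (fun K => ordProd K J * (F z K - G z K)) (by
    intro N
    have e1 := slice_apply hF (fun h => if h ∈ N then starRingEnd ℂ (z h) else z h) J hJ
    have e2 := slice_apply hG (fun h => if h ∈ N then starRingEnd ℂ (z h) else z h) J hJ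
    rw [h, e2, ← sub_eq_zero, ← Finset.sum_sub_distrib] at e1
    rw [← neg_eq_zero, ← Finset.sum_neg_distrib, ← e1]
    refine Finset.sum_congr rfl fun K _ => ?_
    rw [hF.conj_set, hG.conj_set]
    rcases Nat.even_or_odd (K ∩ N).card with h | h
    · simp [h.neg_one_pow, mul_sub]
    · simp only [h.neg_one_pow, neg_smul, one_smul, neg_one_mul, mul_neg, mul_sub]
      abel) T
  exact sub_eq_zero.1 ((mul_eq_zero.1 key).resolve_left (hJ0 T))

theorem stemOf_slice {F : StemFun n} (hF : IsStem F) : stemOf (slice F) = F := by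
  have h : IsSlice (slice F) := ⟨F, hF, rfl⟩
  rw [stemOf, dif_pos h]
  exact (Classical.choose_spec h).1.eq_of_slice_eq hF (Classical.choose_spec h).2

end Almansi

end

noncomputable section

namespace Almansi

variable {n : ℕ}

/-! ### Stem functions with real product components -/

/-! For `q = α + Jβ` and `z = α + iβ`, `q ^ m = Re (z ^ m) + Im (z ^ m) J`. A monomial is thus
induced by a stem function whose component at `T` is the real product of `Im (z_h ^ α_h)` over `h ∈
T` and `Re (z_h ^ α_h)` over `h ∉ T` (`powStem`). Slice multiplication by `x_K` raises the exponents
in `K` by one (`stemMul_powStem`). The spherical derivative keeps the components containing `H` and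
divides by the imaginary parts, so each coordinate in `H` contributes a real factor `Im (z ^ m) / Im
z`, while the others recombine into powers (`component_polyFun`).

It remains to see that `Im (z ^ (k + 1)) / Im z` is the zonal harmonic divided by `k + 1`. This
quotient is the polynomial `chebPoly k`, with a Chebyshev recursion `c_{k+2} = 2 x₀ c_{k+1} - |x|²
c_k`, and it is harmonic on `ℝ⁴`. For the reproducing property, `m (m + d - 1) ∫ p = ∫ Δp` holds on
the sphere of `ℝ^(d+1)` for `p` homogeneous of degree `m` (`sphereInt_laplacian`). It makes harmonic
polynomials orthogonal to homogeneous ones of lower degree, so that `chebPoly k` may be replaced by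
`2 ^ k x₀ ^ k`, and it evaluates `∫ p x₀ ^ k` in terms of `p(1)`. Continuity of polynomials gives
the limits at the remaining points. -/

theorem list_prod_add_smul (l : List (Fin n)) (hl : l.Nodup) (a b : Fin n → ℝ)
    (J : Fin n → ℍ[ℝ]) :
    (l.map fun h => (a h : ℍ[ℝ]) + b h • J h).prod =
      ∑ T ∈ l.toFinset.powerset, (∏ h ∈ l.toFinset, if h ∈ T then b h else a h) •
        ((l.filter (· ∈ T)).map J).prod := by
  induction l with
  | nil => simp
  | cons c l ih =>
    rw [List.nodup_cons] at hl
    have hc : c ∉ l.toFinset := by simpa using hl.1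
    rw [List.map_cons, List.prod_cons, ih hl.2, List.toFinset_cons,
      Finset.sum_powerset_insert hc, add_mul, Finset.mul_sum, Finset.mul_sum]
    congr 1
    · refine Finset.sum_congr rfl fun T hT => ?_
      have hcT : c ∉ T := fun h => hc (Finset.mem_powerset.1 hT h)
      rw [Finset.prod_insert hc, if_neg hcT, List.filter_cons_of_neg (by simpa using hcT),
        mul_smul, Quaternion.coe_mul_eq_smul]
    · refine Finset.sum_congr rfl fun T hT => ?_
      have hcT : c ∉ T := fun h => hc (Finset.mem_powerset.1 hT h)
      rw [Finset.prod_insert hc, if_pos (Finset.mem_insert_self c T),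
        List.filter_cons_of_pos (by simp), List.map_cons, List.prod_cons, mul_smul,
        mul_smul_comm, smul_mul_assoc, smul_comm]
      have h1 : (∏ h ∈ l.toFinset, if h ∈ insert c T then b h else a h) =
          ∏ h ∈ l.toFinset, if h ∈ T then b h else a h := by
        refine Finset.prod_congr rfl fun h hh => ?_
        have : h ≠ c := fun e => hc (e ▸ hh)
        simp [this]
      have h2 : l.filter (· ∈ insert c T) = l.filter (· ∈ T) := by
        refine List.filter_congr fun h hh => ?_
        have : h ≠ c := fun e => hl.1 (e ▸ hh)
        simp [this]
      rw [h1, h2]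

theorem filter_sort_eq (S T : Finset (Fin n)) (h : T ⊆ S) :
    (S.sort (· ≤ ·)).filter (· ∈ T) = T.sort (· ≤ ·) := by
  refine List.Perm.eq_of_pairwise (le := (· ≤ ·)) (fun a b _ _ h1 h2 => le_antisymm h1 h2)
    ((Finset.pairwise_sort S _).filter _) (Finset.pairwise_sort T _) ?_
  rw [List.perm_ext_iff_of_nodup ((Finset.sort_nodup S _).filter _) (Finset.sort_nodup T _)]
  intro x
  simpa using fun hx => h hx

/-- Real scalars are central, so choosing the `J`-term at the indices in `T` leaves these units in
increasing order. -/
theorem ordProd_add_smul (S : Finset (Fin n)) (a b : Fin n → ℝ) (J : Fin n → ℍ[ℝ]) :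
    ordProd S (fun h => (a h : ℍ[ℝ]) + b h • J h) =
      ∑ T ∈ S.powerset, (∏ h ∈ S, if h ∈ T then b h else a h) • ordProd T J := by
  rw [ordProd, list_prod_add_smul _ (Finset.sort_nodup S _), Finset.sort_toFinset]
  refine Finset.sum_congr rfl fun T hT => ?_
  rw [filter_sort_eq S T (Finset.mem_powerset.1 hT), ordProd]

theorem ordProd_congr {S : Finset (Fin n)} {q r : Fin n → ℍ[ℝ]} (h : ∀ i ∈ S, q i = r i) :
    ordProd S q = ordProd S r := by
  unfold ordProd
  congr 1
  exact List.map_congr_left fun i hi => h i (by simpa using hi)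

theorem ordProd_univ_ite (S : Finset (Fin n)) (q : Fin n → ℍ[ℝ]) :
    ordProd Finset.univ (fun i => if i ∈ S then q i else 1) = ordProd S q := by
  rw [ordProd, ordProd, ← filter_sort_eq Finset.univ S (Finset.subset_univ S)]
  generalize (Finset.univ : Finset (Fin n)).sort (· ≤ ·) = l
  induction l with
  | nil => simp
  | cons c l ih => by_cases hc : c ∈ S <;> simp [hc, ih]

/-- The components of `⊗ₕ wₕ` for `wₕ = re wₕ + eₕ im wₕ`. -/
def prodComp (w : Fin n → ℂ) (T : Finset (Fin n)) : ℝ :=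
  ∏ h, if h ∈ T then (w h).im else (w h).re

/-- The stem function `∑_α (⊗ₕ wₕ^{m α h}) a_α` of a polynomial with exponents `m α`. -/
def powStem (m : (Fin n → ℕ) → Fin n → ℕ) (a : (Fin n → ℕ) →₀ ℍ[ℝ]) : StemFun n := fun z T =>
  ∑ α ∈ a.support, prodComp (fun h => z h ^ m α h) T • a α

theorem prodComp_conj (w : Fin n → ℂ) (h : Fin n) (T : Finset (Fin n)) :
    prodComp (conjAt h w) T = (-1) ^ (T ∩ {h}).card * prodComp w T := by
  unfold prodComp
  rw [← Finset.mul_prod_erase _ _ (Finset.mem_univ h),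
    ← Finset.mul_prod_erase (a := h) _ (fun i => if i ∈ T then (w i).im else (w i).re)
      (Finset.mem_univ h), ← mul_assoc]
  congr 1
  · by_cases hT : h ∈ T <;> simp [hT, conjAt]
  · refine Finset.prod_congr rfl fun i hi => ?_
    rw [conjAt, Function.update_of_ne (Finset.ne_of_mem_erase hi)]

theorem isStem_powStem (m : (Fin n → ℕ) → Fin n → ℕ) (a : (Fin n → ℕ) →₀ ℍ[ℝ]) :
    IsStem (powStem m a) := by
  intro z h T
  unfold powStem
  rw [Finset.mul_sum]
  refine Finset.sum_congr rfl fun α _ => ?_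
  have : (fun i => conjAt h z i ^ m α i) = conjAt h (fun i => z i ^ m α i) := by
    funext i
    by_cases hi : i = h
    · subst hi; simp [conjAt]
    · simp [conjAt, hi]
  rw [this, prodComp_conj, mul_smul]
  rcases Nat.even_or_odd (T ∩ {h}).card with e | e <;> simp [e.neg_one_pow]

/-! ### Powers of a quaternion, and polynomials as slice functions -/

theorem norm_im_smul_imUnit (q : ℍ[ℝ]) : ‖q.im‖ • imUnit q = q.im := by
  by_cases h : q.im = 0
  · simp [imUnit, h]
  · rw [imUnit, smul_inv_smul₀ (norm_ne_zero_iff.2 h)]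

/-- The factor `‖q.im‖` keeps this true for real `q`, where `imUnit q` is `0` and does not square to
`-1`. -/
theorem norm_im_smul_imUnit_mul_self (q : ℍ[ℝ]) :
    ‖q.im‖ • (imUnit q * imUnit q) = ((-‖q.im‖ : ℝ) : ℍ[ℝ]) := by
  by_cases h : q.im = 0
  · simp [h]
  · have hn : ‖q.im‖ ≠ 0 := norm_ne_zero_iff.2 h
    have h1 : q.im * q.im = ((-(‖q.im‖ * ‖q.im‖) : ℝ) : ℍ[ℝ]) := by
      rw [← sq, Quaternion.sq_eq_neg_normSq.2 (by simp), Quaternion.normSq_eq_norm_mul_self]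
      simp
    rw [imUnit, smul_mul_smul_comm, h1, smul_smul, ← Quaternion.coe_mul_eq_smul,
      ← Quaternion.coe_mul]
    congr 1
    field_simp

theorem pow_eq_re_add_im (q : ℍ[ℝ]) (m : ℕ) :
    q ^ m = (((toC q ^ m).re : ℝ) : ℍ[ℝ]) + (toC q ^ m).im • imUnit q := by
  induction m with
  | zero => simp
  | succ m ih =>
    have hq : q = (q.re : ℍ[ℝ]) + ‖q.im‖ • imUnit q := by
      rw [norm_im_smul_imUnit, Quaternion.re_add_im]
    have key := norm_im_smul_imUnit_mul_self q
    rw [pow_succ, ih]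
    conv_lhs => arg 2; rw [hq]
    have hre : (toC q).re = q.re := rfl
    have him : (toC q).im = ‖q.im‖ := rfl
    rw [pow_succ, Complex.mul_re, Complex.mul_im, hre, him]
    generalize (toC q ^ m).re = u
    generalize (toC q ^ m).im = v
    have e : v • imUnit q * ‖q.im‖ • imUnit q = ((-(v * ‖q.im‖) : ℝ) : ℍ[ℝ]) := by
      rw [smul_mul_assoc, mul_smul_comm, key, ← Quaternion.coe_mul_eq_smul, ← Quaternion.coe_mul]
      congr 1; ring
    rw [add_mul, mul_add, mul_add, e, Quaternion.coe_mul_eq_smul, Quaternion.coe_mul_eq_smul,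
      Quaternion.mul_coe_eq_smul, smul_smul, smul_smul, add_smul, sub_eq_add_neg,
      Quaternion.coe_add, mul_comm v q.re, ← Quaternion.coe_mul_eq_smul u, ← Quaternion.coe_mul]
    abel

theorem slice_powStem (m : (Fin n → ℕ) → Fin n → ℕ) (a : (Fin n → ℕ) →₀ ℍ[ℝ])
    (x : Fin n → ℍ[ℝ]) :
    slice (powStem m a) x =
      ∑ α ∈ a.support, ordProd Finset.univ (fun i => x i ^ m α i) * a α := by
  simp_rw [slice, powStem, Finset.mul_sum]
  rw [Finset.sum_comm]
  refine Finset.sum_congr rfl fun α _ => ?_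
  simp_rw [pow_eq_re_add_im]
  rw [ordProd_add_smul, Finset.sum_mul, Finset.powerset_univ]
  refine Finset.sum_congr rfl fun T _ => ?_
  rw [prodComp, mul_smul_comm, smul_mul_assoc]

theorem polyFun_eq_slice (a : (Fin n → ℕ) →₀ ℍ[ℝ]) :
    slice (powStem id a) = polyFun a := by
  funext x
  rw [slice_powStem]
  rfl

theorem isSlice_polyFun (a : (Fin n → ℕ) →₀ ℍ[ℝ]) : IsSlice (polyFun a) :=
  ⟨_, isStem_powStem id a, polyFun_eq_slice a⟩

/-- `x_K` is itself a monomial, so its slice product with a polynomial stays among the `powStem`s.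
-/
theorem ordProd_eq_slice (K : Finset (Fin n)) :
    slice (powStem (fun α => α) (Finsupp.single (fun h => if h ∈ K then 1 else 0) 1)) =
      fun x => ordProd K x := by
  funext x
  rw [slice_powStem, Finsupp.support_single _ one_ne_zero, Finset.sum_singleton,
    Finsupp.single_eq_same, mul_one, ← ordProd_univ_ite K]
  congr 1
  funext i
  by_cases hi : i ∈ K <;> simp [hi]

/-! ### Slice product with `x_K` -/

/-- Expand the product over `h` of the real or imaginary part of `v h * w h`; `K` records where the
term with `(v h).im` is chosen. The minus sign of `Re (v h * w h)` occurs on `K \ T = K ∩ (K Δ T)`.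
-/
theorem sum_prodComp_mul (v w : Fin n → ℂ) (T : Finset (Fin n)) :
    ∑ K : Finset (Fin n), (-1) ^ (K ∩ symmDiff K T).card *
      (prodComp v K * prodComp w (symmDiff K T)) = prodComp (fun h => v h * w h) T := by
  have h1 : prodComp (fun h => v h * w h) T = ∏ h,
      ((if h ∈ T then (v h).im * (w h).re else -((v h).im * (w h).im)) +
        (if h ∈ T then (v h).re * (w h).im else (v h).re * (w h).re)) := by
    unfold prodComp
    refine Finset.prod_congr rfl fun h _ => ?_
    split_ifs
    · rw [Complex.mul_im]; ring
    · rw [Complex.mul_re]; ring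
  rw [h1, Finset.prod_add, Finset.powerset_univ]
  refine Finset.sum_congr rfl fun K _ => ?_
  have h2 : ((-1 : ℝ)) ^ (K ∩ symmDiff K T).card =
      ∏ h, if h ∈ K then (if h ∈ T then 1 else -1) else 1 := by
    rw [Finset.prod_ite_mem, Finset.univ_inter, ← Finset.prod_const,
      ← Finset.filter_mem_eq_inter, Finset.prod_filter]
    refine Finset.prod_congr rfl fun h hh => ?_
    by_cases hT : h ∈ T <;> simp [Finset.mem_symmDiff, hh, hT]
  have h3 : ∀ f g : Fin n → ℝ, (∏ h ∈ K, f h) * ∏ h ∈ Finset.univ \ K, g h =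
      ∏ h, if h ∈ K then f h else g h := by
    intro f g
    rw [Finset.prod_ite, Finset.filter_mem_eq_inter, Finset.univ_inter, Finset.filter_not,
      Finset.filter_mem_eq_inter, Finset.univ_inter]
  rw [h2, h3, prodComp, prodComp, ← Finset.prod_mul_distrib, ← Finset.prod_mul_distrib]
  refine Finset.prod_congr rfl fun h _ => ?_
  by_cases hK : h ∈ K <;> by_cases hT : h ∈ T <;> simp [Finset.mem_symmDiff, hK, hT]

theorem stemMul_apply (F G : StemFun n) (z : Fin n → ℂ) (T : Finset (Fin n)) :
    stemMul F G z T =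
      ∑ K : Finset (Fin n), (-1) ^ (K ∩ symmDiff K T).card * (F z K * G z (symmDiff K T)) := by
  refine Finset.sum_congr rfl fun K _ => ?_
  rw [Finset.sum_eq_single (symmDiff K T)]
  · rw [if_pos (symmDiff_symmDiff_cancel_left K T)]
  · intro L _ hL
    refine if_neg fun h => hL ?_
    rw [← h, symmDiff_symmDiff_cancel_left]
  · simp

theorem stemMul_powStem (K : Finset (Fin n)) (a : (Fin n → ℕ) →₀ ℍ[ℝ]) :
    stemMul (powStem (fun α => α) (Finsupp.single (fun h => if h ∈ K then 1 else 0) 1))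
      (powStem id a) = powStem (fun α h => α h + if h ∈ K then 1 else 0) a := by
  funext z T
  rw [stemMul_apply]
  simp_rw [powStem, Finsupp.support_single _ (one_ne_zero (α := ℍ[ℝ])),
    Finset.sum_singleton, Finsupp.single_eq_same, Finset.mul_sum]
  rw [Finset.sum_comm]
  refine Finset.sum_congr rfl fun α _ => ?_
  simp_rw [pow_add, mul_comm (z _ ^ α _)]
  rw [← sum_prodComp_mul, Finset.sum_smul]
  refine Finset.sum_congr rfl fun S _ => ?_
  rw [smul_mul_smul_comm, one_mul, mul_smul]
  rcases Nat.even_or_odd (S ∩ symmDiff S T).card with e | e <;> simp [e.neg_one_pow, smul_smul]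

/-! ### Iterated spherical derivatives and Almansi components -/

theorem foldl_stemDeriv (l : List (Fin n)) (hl : l.Nodup) (F : StemFun n) (z : Fin n → ℂ)
    (T : Finset (Fin n)) :
    l.foldl (fun G h => stemDeriv h G) F z T =
      if Disjoint T l.toFinset then
        (∏ h ∈ l.toFinset, (z h).im⁻¹) • F z (T ∪ l.toFinset) else 0 := by
  induction l generalizing F with
  | nil => simp
  | cons c l ih =>
    rw [List.nodup_cons] at hl
    have hc : c ∉ l.toFinset := by simpa using hl.1
    rw [List.foldl_cons, ih hl.2, List.toFinset_cons, Finset.prod_insert hc,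
      Finset.union_insert, stemDeriv]
    by_cases h1 : Disjoint T l.toFinset <;> by_cases h2 : c ∈ T <;>
      simp [Finset.disjoint_insert_right, h1, h2, hl.1, smul_smul, mul_comm]

theorem stemDerivSet_apply (H : Finset (Fin n)) (F : StemFun n) (z : Fin n → ℂ)
    (T : Finset (Fin n)) :
    stemDerivSet H F z T =
      if Disjoint T H then (∏ h ∈ H, (z h).im⁻¹) • F z (T ∪ H) else 0 := by
  rw [stemDerivSet, foldl_stemDeriv _ (Finset.sort_nodup H _), Finset.sort_toFinset]

/-- Only `T ⊆ Hᶜ` survive. There the component at `T ∪ H` splits into the imaginary parts over `H`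
and the `T`-component in the other coordinates, whose sum over `T` rebuilds the ordered product of
powers. -/
theorem slice_stemDerivSet_powStem (H : Finset (Fin n)) (m : (Fin n → ℕ) → Fin n → ℕ)
    (a : (Fin n → ℕ) →₀ ℍ[ℝ]) (x : Fin n → ℍ[ℝ]) :
    slice (stemDerivSet H (powStem m a)) x = ∑ α ∈ a.support,
      ((∏ h ∈ H, (‖(x h).im‖⁻¹ * (toC (x h) ^ m α h).im) : ℝ) : ℍ[ℝ]) *
        ordProd Hᶜ (fun i => x i ^ m α i) * a α := by
  have hps : (Finset.univ.filter fun T : Finset (Fin n) => Disjoint T H) = Hᶜ.powerset := by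
    ext T
    simp [Finset.subset_compl_iff_disjoint_right]
  simp_rw [slice, stemDerivSet_apply, mul_ite, mul_zero]
  rw [← Finset.sum_filter, hps]
  simp_rw [powStem, Finset.smul_sum, Finset.mul_sum]
  rw [Finset.sum_comm]
  refine Finset.sum_congr rfl fun α _ => ?_
  simp_rw [pow_eq_re_add_im]
  rw [ordProd_add_smul, Finset.mul_sum, Finset.sum_mul]
  refine Finset.sum_congr rfl fun T hT => ?_
  have hTH : Disjoint T H := by
    rwa [Finset.mem_powerset, Finset.subset_compl_iff_disjoint_right] at hT
  have h1 : prodComp (fun h => toC (x h) ^ m α h) (T ∪ H) =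
      (∏ h ∈ H, (toC (x h) ^ m α h).im) * ∏ h ∈ Hᶜ, if h ∈ T then (toC (x h) ^ m α h).im
        else (toC (x h) ^ m α h).re := by
    rw [prodComp, ← Finset.prod_mul_prod_compl H]
    congr 1
    · exact Finset.prod_congr rfl fun h hh => by simp [hh]
    · exact Finset.prod_congr rfl fun h hh => by simp [Finset.mem_compl.1 hh]
  rw [h1, Quaternion.coe_mul_eq_smul, mul_smul_comm, mul_smul_comm, smul_smul, smul_smul,
    smul_mul_assoc, Finset.prod_mul_distrib, mul_assoc]
  rfl

theorem component_polyFun (H K : Finset (Fin n)) (a : (Fin n → ℕ) →₀ ℍ[ℝ]) (hK : K ⊆ H)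
    (x : Fin n → ℍ[ℝ]) :
    component H K (polyFun a) x = ∑ α ∈ a.support,
      ((∏ h ∈ H, (‖(x h).im‖⁻¹ * (toC (x h) ^ (α h + if h ∈ K then 1 else 0)).im) : ℝ) : ℍ[ℝ]) *
        ordProd Hᶜ (fun i => x i ^ α i) * a α := by
  rw [component, sphericalDeriv, sliceMul, ← polyFun_eq_slice, ← ordProd_eq_slice,
    stemOf_slice (isStem_powStem _ _), stemOf_slice (isStem_powStem _ _), stemMul_powStem,
    stemOf_slice (isStem_powStem _ _), slice_stemDerivSet_powStem]
  refine Finset.sum_congr rfl fun α _ => ?_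
  congr 2
  refine ordProd_congr fun i hi => ?_
  -- Since `K ⊆ H`, exponents outside `H` are not raised.
  rw [if_neg (fun h => Finset.mem_compl.1 hi (hK h)), add_zero]

/-! ### Homogeneous polynomials and integrals over the sphere -/

section Sphere

open MvPolynomial

/-- The Laplacian of a polynomial. -/
def laplacian {σ : Type*} [Fintype σ] (p : MvPolynomial σ ℝ) : MvPolynomial σ ℝ :=
  ∑ i, pderiv i (pderiv i p)

theorem laplacian_mul {σ : Type*} [Fintype σ] (p q : MvPolynomial σ ℝ) :
    laplacian (p * q) =
      laplacian p * q + (2 : ℝ) • ∑ i, pderiv i p * pderiv i q + p * laplacian q := by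
  simp only [laplacian, Finset.sum_mul, Finset.mul_sum, Finset.smul_sum,
    ← Finset.sum_add_distrib]
  refine Finset.sum_congr rfl fun i _ => ?_
  simp only [Derivation.leibniz, map_add, smul_eq_mul, MvPolynomial.smul_eq_C_mul, map_ofNat]
  ring

theorem pderiv_eq_zero_of_isHomogeneous_zero {σ : Type*} {p : MvPolynomial σ ℝ}
    (hp : p.IsHomogeneous 0) (i : σ) : pderiv i p = 0 := by
  rw [← totalDegree_zero_iff_isHomogeneous, totalDegree_eq_zero_iff_eq_C] at hp
  rw [hp, pderiv_C]

theorem laplacian_isHomogeneous {σ : Type*} [Fintype σ] {m : ℕ} {p : MvPolynomial σ ℝ}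
    (hp : p.IsHomogeneous m) : (laplacian p).IsHomogeneous (m - 2) :=
  IsHomogeneous.sum _ _ _ fun _ _ => hp.pderiv.pderiv

/-- Covers the degrees in which `m - 2` is truncated. -/
theorem laplacian_eq_zero_of_lt_two {σ : Type*} [Fintype σ] {m : ℕ} {p : MvPolynomial σ ℝ}
    (hp : p.IsHomogeneous m) (hm : m < 2) : laplacian p = 0 := by
  refine Finset.sum_eq_zero fun i _ => pderiv_eq_zero_of_isHomogeneous_zero ?_ i
  have := hp.pderiv (i := i)
  rwa [show m - 1 = 0 by omega] at this

theorem eval_smul_of_isHomogeneous {σ : Type*} {m : ℕ} {p : MvPolynomial σ ℝ}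
    (hp : p.IsHomogeneous m) (r : ℝ) (x : σ → ℝ) :
    eval (fun i => r * x i) p = r ^ m * eval x p := by
  rw [eval_eq, eval_eq, Finset.mul_sum]
  refine Finset.sum_congr rfl fun d hd => ?_
  have : ∑ i ∈ d.support, d i = m := (hp.degree_eq_sum_deg_support hd).symm
  simp_rw [mul_pow]
  rw [Finset.prod_mul_distrib, Finset.prod_pow_eq_pow_sum, this]
  ring

theorem hasLineDerivAt_eval {d : ℕ} (p : MvPolynomial (Fin d) ℝ)
    (x : EuclideanSpace ℝ (Fin d)) (i : Fin d) :
    HasLineDerivAt ℝ (fun y : EuclideanSpace ℝ (Fin d) => eval (fun j => y j) p)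
      (eval (fun j => x j) (pderiv i p)) x (EuclideanSpace.single i 1) := by
  unfold HasLineDerivAt
  induction p using MvPolynomial.induction_on with
  | C a => simpa using hasDerivAt_const (0 : ℝ) a
  | add p q hp hq => simp only [map_add]; exact hp.add hq
  | mul_X p j hp =>
    have hX : HasDerivAt (fun t : ℝ => (x + t • EuclideanSpace.single i (1 : ℝ)) j)
        (if i = j then 1 else 0) 0 := by
      by_cases h : i = j
      · subst h
        simpa using (hasDerivAt_id (0 : ℝ)).const_add (x i)
      · have h' : j ≠ i := fun e => h e.symm
        simpa [h, h'] using hasDerivAt_const (0 : ℝ) (x j)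
    -- The base point is kept as `x + 0 • e_i`, the form in which `HasDerivAt.mul` produces it.
    have h : eval (fun j => x j) (pderiv i (p * X j)) =
        eval (fun j => x j) (pderiv i p) * (x + (0 : ℝ) • EuclideanSpace.single i (1 : ℝ)) j +
          eval (fun j => (x + (0 : ℝ) • EuclideanSpace.single i (1 : ℝ)) j) p *
            (if i = j then 1 else 0) := by
      rw [zero_smul, add_zero]
      by_cases h : i = j
      · subst h
        simp [Derivation.leibniz]
        ring
      · have h' : j ≠ i := fun e => h e.symm
        simp [Derivation.leibniz, pderiv_X_of_ne h', h]
        ring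
    rw [h]
    simp only [map_mul, eval_X]
    exact hp.mul hX

/-! ### Gaussian integrals, polar coordinates and the Laplacian -/

theorem integrable_norm_pow_mul_exp (d N : ℕ) :
    Integrable fun x : EuclideanSpace ℝ (Fin (d + 1)) => ‖x‖ ^ N * Real.exp (-‖x‖ ^ 2) := by
  rw [integrable_fun_norm_addHaar (μ := volume)
    (f := fun r : ℝ => r ^ N * Real.exp (-r ^ 2))]
  have h := integrableOn_rpow_mul_exp_neg_mul_sq (b := 1) one_pos
    (s := ((d + N : ℕ) : ℝ)) (by have := Nat.cast_nonneg (α := ℝ) (d + N); linarith)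
  refine h.congr_fun (fun r _ => ?_) measurableSet_Ioi
  simp only [Real.rpow_natCast, finrank_euclideanSpace, Fintype.card_fin, smul_eq_mul,
    Nat.add_sub_cancel, pow_add, neg_mul, one_mul]
  ring

theorem continuous_eval_euclidean {d : ℕ} (p : MvPolynomial (Fin d) ℝ) :
    Continuous fun x : EuclideanSpace ℝ (Fin d) => eval (fun i => x i) p :=
  p.continuous_eval.comp (by fun_prop)

theorem integrable_eval_mul_exp {d : ℕ} (p : MvPolynomial (Fin (d + 1)) ℝ) :
    Integrable fun x : EuclideanSpace ℝ (Fin (d + 1)) =>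
      eval (fun i => x i) p * Real.exp (-‖x‖ ^ 2) := by
  simp_rw [eval_eq', Finset.sum_mul]
  refine integrable_finsetSum _ fun m _ => ?_
  refine ((integrable_norm_pow_mul_exp d (∑ i, m i)).const_mul |coeff m p|).mono'
    (Continuous.aestronglyMeasurable (by fun_prop)) (Filter.Eventually.of_forall fun x => ?_)
  rw [norm_mul, norm_mul, Real.norm_of_nonneg (Real.exp_nonneg _), ← mul_assoc, Real.norm_eq_abs]
  gcongr
  rw [norm_prod, ← Finset.prod_pow_eq_pow_sum]
  refine Finset.prod_le_prod (fun _ _ => norm_nonneg _) fun i _ => ?_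
  rw [norm_pow]
  exact pow_le_pow_left₀ (norm_nonneg _) (PiLp.norm_apply_le x i) _

/-- Integration by parts, as `∂_i exp (-|x|²) = -2 x_i exp (-|x|²)`. -/
theorem integral_X_mul_exp {d : ℕ} (p : MvPolynomial (Fin (d + 1)) ℝ) (i : Fin (d + 1)) :
    2 * ∫ x : EuclideanSpace ℝ (Fin (d + 1)), eval (fun j => x j) (X i * p) *
      Real.exp (-‖x‖ ^ 2) =
    ∫ x : EuclideanSpace ℝ (Fin (d + 1)), eval (fun j => x j) (pderiv i p) *
      Real.exp (-‖x‖ ^ 2) := by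
  have hg : ∀ x : EuclideanSpace ℝ (Fin (d + 1)), HasLineDerivAt ℝ
      (fun y : EuclideanSpace ℝ (Fin (d + 1)) => Real.exp (-‖y‖ ^ 2))
      (-(2 * x i) * Real.exp (-‖x‖ ^ 2)) x (EuclideanSpace.single i 1) := by
    intro x
    have h := ((hasStrictFDerivAt_norm_sq x).hasFDerivAt.neg.exp).hasLineDerivAt
      (EuclideanSpace.single i (1 : ℝ))
    have hv : -(2 * x i) * Real.exp (-‖x‖ ^ 2) = (Real.exp (-‖x‖ ^ 2) •
        -(2 • (innerSL ℝ) x)) (EuclideanSpace.single i (1 : ℝ)) := by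
      simp [EuclideanSpace.inner_single_right]
      ring
    rw [hv]
    exact h
  have hfg' : ∀ x : EuclideanSpace ℝ (Fin (d + 1)),
      eval (fun j => x j) p * (-(2 * x i) * Real.exp (-‖x‖ ^ 2)) =
        -2 * (eval (fun j => x j) (X i * p) * Real.exp (-‖x‖ ^ 2)) := by
    intro x
    simp only [map_mul, eval_X]
    ring
  have key := integral_bilinear_hasLineDerivAt_right_eq_neg_left_of_integrable
    (μ := (volume : Measure (EuclideanSpace ℝ (Fin (d + 1)))))
    (B := ContinuousLinearMap.mul ℝ ℝ)
    (f := fun x => eval (fun j => x j) p) (f' := fun x => eval (fun j => x j) (pderiv i p))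
    (g := fun x => Real.exp (-‖x‖ ^ 2)) (g' := fun x => -(2 * x i) * Real.exp (-‖x‖ ^ 2))
    (v := EuclideanSpace.single i 1)
    (integrable_eval_mul_exp _)
    (by simpa only [ContinuousLinearMap.mul_apply', hfg'] using
      (integrable_eval_mul_exp (X i * p)).const_mul (-2))
    (integrable_eval_mul_exp _) (fun x _ => hasLineDerivAt_eval p x i) (fun x _ => hg x)
  simp only [ContinuousLinearMap.mul_apply', hfg', integral_const_mul] at key
  linarith

/-- Apply the integration by parts to each `∂_i p` and sum, using Euler's identity `∑ x_i ∂_i p = m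
p`. -/
theorem integral_laplacian_mul_exp {d m : ℕ} {p : MvPolynomial (Fin (d + 1)) ℝ}
    (hp : p.IsHomogeneous m) :
    2 * m * ∫ x : EuclideanSpace ℝ (Fin (d + 1)), eval (fun j => x j) p *
      Real.exp (-‖x‖ ^ 2) =
    ∫ x : EuclideanSpace ℝ (Fin (d + 1)), eval (fun j => x j) (laplacian p) *
      Real.exp (-‖x‖ ^ 2) := by
  simp only [laplacian, map_sum, Finset.sum_mul]
  rw [integral_finsetSum _ fun i _ => integrable_eval_mul_exp _]
  simp_rw [← integral_X_mul_exp]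
  rw [← Finset.mul_sum, ← integral_finsetSum _ fun i _ => integrable_eval_mul_exp _]
  simp_rw [← Finset.sum_mul, ← map_sum, hp.sum_X_mul_pderiv, nsmul_eq_mul, map_mul, map_natCast,
    mul_assoc]
  rw [integral_const_mul]

/-- The integral over the unit sphere of `ℝᵈ`, for polynomials. -/
def sphereInt (d : ℕ) : MvPolynomial (Fin d) ℝ →ₗ[ℝ] ℝ where
  toFun p := ∫ ζ : Metric.sphere (0 : EuclideanSpace ℝ (Fin d)) 1,
    eval (fun i => (ζ : EuclideanSpace ℝ (Fin d)) i) p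
      ∂((volume : Measure (EuclideanSpace ℝ (Fin d))).toSphere)
  map_add' p q := by
    have h : ∀ p : MvPolynomial (Fin d) ℝ, Integrable
        (fun ζ : Metric.sphere (0 : EuclideanSpace ℝ (Fin d)) 1 =>
          eval (fun i => (ζ : EuclideanSpace ℝ (Fin d)) i) p)
        (volume : Measure (EuclideanSpace ℝ (Fin d))).toSphere := fun p =>
      ((continuous_eval_euclidean p).comp continuous_subtype_val).integrable_of_hasCompactSupport
        (HasCompactSupport.of_compactSpace _)
    simp only [map_add]
    exact integral_add (h p) (h q)
  map_smul' c p := by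
    simp only [smul_eval, integral_const_mul, RingHom.id_apply, smul_eq_mul]

theorem sphereInt_apply (d : ℕ) (p : MvPolynomial (Fin d) ℝ) :
    sphereInt d p = ∫ ζ : Metric.sphere (0 : EuclideanSpace ℝ (Fin d)) 1,
      eval (fun i => (ζ : EuclideanSpace ℝ (Fin d)) i) p
        ∂((volume : Measure (EuclideanSpace ℝ (Fin d))).toSphere) := rfl

theorem integral_eval_mul_exp_polar {d m : ℕ} {p : MvPolynomial (Fin (d + 1)) ℝ}
    (hp : p.IsHomogeneous m) :
    ∫ x : EuclideanSpace ℝ (Fin (d + 1)), eval (fun j => x j) p * Real.exp (-‖x‖ ^ 2) =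
      sphereInt (d + 1) p * (Real.Gamma ((m + d + 1 : ℝ) / 2) / 2) := by
  have hrad : ∫ r : Set.Ioi (0 : ℝ), (r : ℝ) ^ m * Real.exp (-(r : ℝ) ^ 2)
      ∂(Measure.volumeIoiPow (Module.finrank ℝ (EuclideanSpace ℝ (Fin (d + 1))) - 1)) =
        Real.Gamma ((m + d + 1 : ℝ) / 2) / 2 := by
    have h := integral_rpow_mul_exp_neg_rpow (p := 2) (q := ((m + d : ℕ) : ℝ)) two_pos
      (by have := Nat.cast_nonneg (α := ℝ) (m + d); linarith)
    simp only [Measure.volumeIoiPow, ENNReal.ofReal]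
    rw [integral_withDensity_eq_integral_smul
      (measurable_subtype_coe.pow_const _).real_toNNReal,
      integral_subtype_comap measurableSet_Ioi fun a : ℝ =>
        Real.toNNReal (a ^ (Module.finrank ℝ (EuclideanSpace ℝ (Fin (d + 1))) - 1)) •
          (a ^ m * Real.exp (-a ^ 2))]
    rw [show Real.Gamma ((m + d + 1 : ℝ) / 2) / 2 =
      1 / 2 * Real.Gamma ((((m + d : ℕ) : ℝ) + 1) / 2) by push_cast; ring, ← h]
    refine setIntegral_congr_fun measurableSet_Ioi fun r hr => ?_
    simp only [NNReal.smul_def, Real.coe_toNNReal _ (pow_nonneg (le_of_lt hr) _),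
      finrank_euclideanSpace, Fintype.card_fin, Nat.add_sub_cancel, smul_eq_mul,
      Real.rpow_natCast, pow_add, Real.rpow_ofNat]
    ring
  rw [← hrad, sphereInt_apply, ← integral_prod_mul,
    ← (Measure.measurePreserving_homeomorphUnitSphereProd
      (volume : Measure (EuclideanSpace ℝ (Fin (d + 1))))).integral_comp
      (Homeomorph.measurableEmbedding _)]
  -- Polar coordinates live on the complement of the origin, a null set being discarded.
  have h0 := integral_subtype_comap (μ := volume)
    (measurableSet_singleton (0 : EuclideanSpace ℝ (Fin (d + 1)))).compl
    fun x => eval (fun j => x j) p * Real.exp (-‖x‖ ^ 2)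
  rw [restrict_compl_singleton] at h0
  rw [← h0]
  refine integral_congr_ae (Filter.Eventually.of_forall fun x => ?_)
  have hx : ‖(x : EuclideanSpace ℝ (Fin (d + 1)))‖ ≠ 0 := norm_ne_zero_iff.2 x.2
  simp only [homeomorphUnitSphereProd_apply_fst_coe, homeomorphUnitSphereProd_apply_snd_coe]
  have h1 : eval (fun j => (‖(x : EuclideanSpace ℝ (Fin (d + 1)))‖⁻¹ •
      (x : EuclideanSpace ℝ (Fin (d + 1)))) j) p =
      ‖(x : EuclideanSpace ℝ (Fin (d + 1)))‖⁻¹ ^ m * eval (fun j => x.1 j) p :=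
    eval_smul_of_isHomogeneous hp _ _
  rw [h1, inv_pow]
  field_simp

/-- Write both sides of the Gaussian identity in polar coordinates. The radial factors for degrees
`m` and `m - 2` differ by `(m + d - 1) / 2`, by `Γ(s + 1) = s Γ(s)`. For `m < 2` both sides vanish.
-/
theorem sphereInt_laplacian {d m : ℕ} {p : MvPolynomial (Fin (d + 1)) ℝ}
    (hp : p.IsHomogeneous m) :
    m * (m + d - 1) * sphereInt (d + 1) p = sphereInt (d + 1) (laplacian p) := by
  have key := integral_laplacian_mul_exp hp
  rcases lt_or_ge m 2 with hm | hm
  · rw [laplacian_eq_zero_of_lt_two hp hm] at key ⊢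
    rw [integral_eval_mul_exp_polar hp] at key
    have hG : Real.Gamma ((m + d + 1 : ℝ) / 2) ≠ 0 := (Real.Gamma_pos_of_pos (by positivity)).ne'
    simp only [map_zero, zero_mul, integral_zero] at key ⊢
    have : (m : ℝ) * sphereInt (d + 1) p = 0 := by
      have h2 : (m : ℝ) * sphereInt (d + 1) p * Real.Gamma ((m + d + 1 : ℝ) / 2) = 0 := by
        linarith
      exact (mul_eq_zero.1 h2).resolve_right hG
    linear_combination (m + d - 1 : ℝ) * this
  · obtain ⟨k, rfl⟩ := Nat.exists_eq_add_of_le' hm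
    rw [integral_eval_mul_exp_polar hp, integral_eval_mul_exp_polar (laplacian_isHomogeneous hp),
      Nat.add_sub_cancel] at key
    have hpos : (0 : ℝ) < (k + d + 1) / 2 := by positivity
    have hG : Real.Gamma ((k + d + 1 : ℝ) / 2) ≠ 0 := (Real.Gamma_pos_of_pos hpos).ne'
    rw [show (((k + 2 : ℕ) : ℝ) + d + 1) / 2 = (k + d + 1) / 2 + 1 by push_cast; ring,
      Real.Gamma_add_one hpos.ne'] at key
    refine mul_right_cancel₀ hG ?_
    push_cast at key ⊢
    linear_combination 2 * key

/-- The polynomial `|x|²`. -/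
def normSqPoly (d : ℕ) : MvPolynomial (Fin d) ℝ := ∑ i, X i ^ 2

theorem sphereInt_normSqPoly_mul {d : ℕ} (p : MvPolynomial (Fin d) ℝ) :
    sphereInt d (normSqPoly d * p) = sphereInt d p := by
  rw [sphereInt_apply, sphereInt_apply]
  congr 1
  funext ζ
  have h : ‖(ζ : EuclideanSpace ℝ (Fin d))‖ ^ 2 = 1 := by
    rw [norm_eq_of_mem_sphere, one_pow]
  rw [EuclideanSpace.real_norm_sq_eq] at h
  simp [normSqPoly, h]

/-- A continuous nonnegative function with zero integral vanishes on the sphere; homogeneity extends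
this to all of space. -/
theorem sphereInt_eq_zero_of_mul_self {d k : ℕ} {p : MvPolynomial (Fin (d + 1)) ℝ}
    (hp : p.IsHomogeneous k) (h : sphereInt (d + 1) (p * p) = 0) : p = 0 := by
  have hc : Continuous fun ζ : Metric.sphere (0 : EuclideanSpace ℝ (Fin (d + 1))) 1 =>
      eval (fun i => (ζ : EuclideanSpace ℝ (Fin (d + 1))) i) (p * p) :=
    (continuous_eval_euclidean _).comp continuous_subtype_val
  have hs : ∀ ζ : Metric.sphere (0 : EuclideanSpace ℝ (Fin (d + 1))) 1,
      eval (fun i => (ζ : EuclideanSpace ℝ (Fin (d + 1))) i) p = 0 := by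
    intro ζ
    by_contra hζ
    have := hc.integral_pos_of_hasCompactSupport_nonneg_nonzero (x := ζ)
      (μ := (volume : Measure (EuclideanSpace ℝ (Fin (d + 1)))).toSphere)
      (HasCompactSupport.of_compactSpace _)
      (fun ξ => by rw [map_mul]; exact mul_self_nonneg _) (by simpa using hζ)
    exact this.ne' h
  refine MvPolynomial.IsHomogeneous.eq_zero_of_forall_eval_eq_zero hp fun x => ?_
  by_cases hx : WithLp.toLp 2 x = (0 : EuclideanSpace ℝ (Fin (d + 1)))
  -- The origin is `0` times a point of the sphere; this also covers degree `0`.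
  · have hx0 : x = fun i => 0 * (EuclideanSpace.single 0 1 : EuclideanSpace ℝ (Fin (d + 1))) i := by
      funext i
      simpa using congrArg (fun y : EuclideanSpace ℝ (Fin (d + 1)) => y i) hx
    have h1 := hs ⟨EuclideanSpace.single 0 1, by simp⟩
    rw [hx0, eval_smul_of_isHomogeneous hp, h1, mul_zero]
  · have hn : ‖(WithLp.toLp 2 x : EuclideanSpace ℝ (Fin (d + 1)))‖ ≠ 0 := norm_ne_zero_iff.2 hx
    have h1 := hs ⟨‖(WithLp.toLp 2 x : EuclideanSpace ℝ (Fin (d + 1)))‖⁻¹ • WithLp.toLp 2 x, by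
      simp [norm_smul, hn]⟩
    have h2 := eval_smul_of_isHomogeneous hp ‖(WithLp.toLp 2 x : EuclideanSpace ℝ (Fin (d + 1)))‖⁻¹ x
    rw [show eval (fun i => ‖(WithLp.toLp 2 x : EuclideanSpace ℝ (Fin (d + 1)))‖⁻¹ * x i) p = 0 from h1]
      at h2
    exact (mul_eq_zero.1 h2.symm).resolve_left (pow_ne_zero _ (inv_ne_zero hn))

end Sphere

/-! ### Zonal harmonics of `ℝ⁴` with pole `1` -/

section Zonal

open MvPolynomial

/-- The commutator of two derivations is a derivation, here zero on the variables. -/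
theorem pderiv_comm {σ : Type*} (i j : σ) (p : MvPolynomial σ ℝ) :
    pderiv i (pderiv j p) = pderiv j (pderiv i p) := by
  classical
  have h : ⁅pderiv (R := ℝ) i, pderiv (R := ℝ) j⁆ = 0 := by
    refine MvPolynomial.derivation_ext fun k => ?_
    rw [Derivation.commutator_apply, pderiv_X, pderiv_X]
    simp only [Pi.single_apply]
    split_ifs <;> simp
  have := DFunLike.congr_fun h p
  simpa [Derivation.commutator_apply, sub_eq_zero] using this

theorem laplacian_pderiv {σ : Type*} [Fintype σ] (i : σ) (p : MvPolynomial σ ℝ) :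
    laplacian (pderiv i p) = pderiv i (laplacian p) := by
  rw [laplacian, laplacian, map_sum]
  exact Finset.sum_congr rfl fun j _ => by rw [pderiv_comm j i p, pderiv_comm j i]

/-- Since `Δp = 0`, `Δ(pq) = 2 ∇p·∇q + p Δq`. Each term is again harmonic times homogeneous of
strictly smaller degree, so induction on `d` gives `∫ Δ(pq) = 0`, and the factor `(k + d) (k + d +
e)` is positive. -/
theorem sphereInt_harmonic_mul_eq_zero {e : ℕ} (d k : ℕ) (hdk : d < k)
    {p q : MvPolynomial (Fin (e + 2)) ℝ} (hp : p.IsHomogeneous k) (hpl : laplacian p = 0)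
    (hq : q.IsHomogeneous d) : sphereInt (e + 2) (p * q) = 0 := by
  induction d using Nat.strong_induction_on generalizing k p q with
  | _ d ih =>
    have h := sphereInt_laplacian (hp.mul hq)
    have h0 : sphereInt (e + 2) (laplacian (p * q)) = 0 := by
      rw [laplacian_mul, hpl, zero_mul, zero_add, map_add, map_smul, map_sum]
      have h1 : ∀ i, sphereInt (e + 2) (pderiv i p * pderiv i q) = 0 := by
        intro i
        rcases Nat.eq_zero_or_pos d with hd | hd
        · subst hd
          rw [pderiv_eq_zero_of_isHomogeneous_zero hq, mul_zero, map_zero]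
        · refine ih (d - 1) (by omega) (k - 1) (by omega) hp.pderiv ?_ hq.pderiv
          rw [laplacian_pderiv, hpl, map_zero]
      have h2 : sphereInt (e + 2) (p * laplacian q) = 0 := by
        rcases lt_or_ge d 2 with hd | hd
        · rw [laplacian_eq_zero_of_lt_two hq hd, mul_zero, map_zero]
        · exact ih (d - 2) (by omega) k (by omega) hp hpl (laplacian_isHomogeneous hq)
      simp [h1, h2]
    rw [h0] at h
    have hk : (0 : ℝ) < k := by exact_mod_cast (Nat.zero_le d).trans_lt hdk
    refine (mul_eq_zero.1 h).resolve_left ?_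
    have : (0 : ℝ) < ((k + d : ℕ) : ℝ) * (((k + d : ℕ) : ℝ) + ((e + 1 : ℕ) : ℝ) - 1) := by
      push_cast
      have hd := Nat.cast_nonneg (α := ℝ) d
      have he := Nat.cast_nonneg (α := ℝ) e
      exact mul_pos (by linarith) (by linarith)
    exact this.ne'

/-- The pole `1` of the sphere `S³`. -/
def pole : Fin 4 → ℝ := Pi.single 0 1

/-- Passing from `p` to `∂₀p` lowers the degree: in `Δ(p x₀ ^ (k + 1))` the term with `p x₀ ^ (k -
1)` integrates to zero by orthogonality, leaving `2 (k + 2) ∫ p x₀ ^ (k + 1) = ∫ ∂₀p x₀ ^ k`. -/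
theorem sphereInt_harmonic_mul_X_pow (k : ℕ) {p : MvPolynomial (Fin 4) ℝ}
    (hp : p.IsHomogeneous k) (hpl : laplacian p = 0) :
    2 ^ k * (k + 1) * sphereInt 4 (p * X 0 ^ k) = eval pole p * sphereInt 4 1 := by
  induction k generalizing p with
  | zero =>
    rw [← totalDegree_zero_iff_isHomogeneous, totalDegree_eq_zero_iff_eq_C] at hp
    rw [hp, pow_zero, pow_zero, ← smul_eq_C_mul, map_smul, eval_C]
    simp
  | succ k ih =>
    have h1 := ih hp.pderiv (p := pderiv 0 p) (by rw [laplacian_pderiv, hpl, map_zero])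
    have h2 := sphereInt_laplacian (hp.mul (isHomogeneous_X_pow (R := ℝ) (0 : Fin 4) (k + 1)))
    have hd : ∀ i : Fin 4, i ≠ 0 → ∀ m, pderiv i ((X 0 : MvPolynomial (Fin 4) ℝ) ^ m) = 0 := by
      intro i hi m
      rw [Derivation.leibniz_pow, pderiv_X_of_ne hi.symm]
      simp
    have hd0 : ∀ m : ℕ, pderiv 0 ((X 0 : MvPolynomial (Fin 4) ℝ) ^ m) =
        (m : ℝ) • X 0 ^ (m - 1) := by
      intro m
      rw [Derivation.leibniz_pow, pderiv_X_self]
      simp [smul_eq_C_mul]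
    have h3 : laplacian (p * X 0 ^ (k + 1)) = (2 * (k + 1) : ℝ) • (pderiv 0 p * X 0 ^ k) +
        ((k + 1) * k : ℝ) • (p * X 0 ^ (k - 1)) := by
      have e1 : laplacian ((X 0 : MvPolynomial (Fin 4) ℝ) ^ (k + 1)) =
          ((k + 1) * k : ℝ) • X 0 ^ (k - 1) := by
        rw [laplacian, Fin.sum_univ_four, hd 1 (by decide), hd 2 (by decide), hd 3 (by decide), hd0,
          Nat.add_sub_cancel, Derivation.map_smul, hd0]
        simp [smul_smul]
      rw [laplacian_mul, hpl, e1, Fin.sum_univ_four, hd 1 (by decide), hd 2 (by decide),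
        hd 3 (by decide), hd0, Nat.add_sub_cancel]
      simp only [smul_eq_C_mul, map_mul, map_add, map_natCast, map_one, map_ofNat, Nat.cast_add,
        Nat.cast_one]
      ring
    have h4 : sphereInt 4 (p * X 0 ^ (k - 1)) = 0 :=
      sphereInt_harmonic_mul_eq_zero (e := 2) (k - 1) (k + 1) (by omega) hp hpl
        (isHomogeneous_X_pow _ _)
    -- Euler's identity at the pole, where only `x₀` is nonzero.
    have h5 : eval pole (pderiv 0 p) = (k + 1) * eval pole p := by
      have := congrArg (eval pole) hp.sum_X_mul_pderiv
      simpa [Fin.sum_univ_four, pole] using this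
    rw [h3, map_add, map_smul, map_smul, h4] at h2
    rw [h5] at h1
    have hk : ((k : ℝ) + 1) ≠ 0 := by positivity
    refine mul_left_cancel₀ hk ?_
    push_cast [smul_eq_mul] at h2 h1 ⊢
    rw [← mul_assoc _ (eval pole p), ← h1]
    have h6 : 2 * ((k : ℝ) + 2) * sphereInt 4 (p * X 0 ^ (k + 1)) =
        sphereInt 4 (pderiv 0 p * X 0 ^ k) := by
      refine mul_left_cancel₀ (mul_ne_zero two_ne_zero hk) ?_
      linear_combination h2
    linear_combination 2 ^ k * ((k : ℝ) + 1) * h6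

/-- The polynomial `Im (z ^ (k + 1)) / Im z` in the coordinates of `x = α + J β`, `z = α + i β`. -/
def chebPoly : ℕ → MvPolynomial (Fin 4) ℝ
  | 0 => 1
  | 1 => (2 : ℝ) • X 0
  | k + 2 => (2 : ℝ) • (X 0 * chebPoly (k + 1)) - normSqPoly 4 * chebPoly k

theorem chebPoly_isHomogeneous : ∀ k, (chebPoly k).IsHomogeneous k
  | 0 => isHomogeneous_one _ _
  | 1 => by
    rw [chebPoly, smul_eq_C_mul]
    exact (isHomogeneous_X _ _).C_mul _
  | k + 2 => by
    rw [chebPoly, smul_eq_C_mul]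
    refine IsHomogeneous.sub (IsHomogeneous.C_mul ?_ _) ?_
    · have := (isHomogeneous_X ℝ (0 : Fin 4)).mul (chebPoly_isHomogeneous (k + 1))
      rwa [show 1 + (k + 1) = k + 2 by ring] at this
    · have := (IsHomogeneous.sum Finset.univ (fun i : Fin 4 => (X i : MvPolynomial (Fin 4) ℝ) ^ 2) 2
        fun i _ => isHomogeneous_X_pow i 2).mul (chebPoly_isHomogeneous k)
      rwa [add_comm 2 k] at this

theorem pderiv_normSqPoly (i : Fin 4) : pderiv i (normSqPoly 4) = (2 : ℝ) • X i := by
  rw [normSqPoly, map_sum, Finset.sum_eq_single i]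
  · rw [Derivation.leibniz_pow, pderiv_X_self]
    simp [smul_eq_C_mul, ← map_ofNat (C : ℝ →+* MvPolynomial (Fin 4) ℝ)]
  · intro j _ hj
    rw [Derivation.leibniz_pow, pderiv_X_of_ne hj]
    simp
  · simp

/-- Reflects `∂_α Im (z ^ (k + 2)) = (k + 2) Im (z ^ (k + 1))` at fixed `β`; it supplies the cross
term in the Laplacian of `x₀ c_{k+1}`. -/
theorem pderiv_zero_chebPoly : ∀ k : ℕ,
    pderiv 0 (chebPoly (k + 1)) = ((k : ℝ) + 2) • chebPoly k
  | 0 => by simp [chebPoly]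
  | 1 => by
    simp only [chebPoly, map_sub, Derivation.map_smul, Derivation.leibniz, pderiv_normSqPoly,
      pderiv_X_self, pderiv_one]
    simp only [smul_eq_C_mul, smul_eq_mul, map_add, map_ofNat, map_one, Nat.cast_one]
    ring
  | k + 2 => by
    have h1 := pderiv_zero_chebPoly k
    have h2 := pderiv_zero_chebPoly (k + 1)
    rw [chebPoly, map_sub, Derivation.map_smul, Derivation.leibniz, Derivation.leibniz, h1, h2,
      pderiv_normSqPoly, pderiv_X_self, chebPoly]
    simp only [smul_eq_C_mul, smul_eq_mul, map_add, map_natCast, map_ofNat, Nat.cast_add,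
      Nat.cast_one, Nat.cast_ofNat, map_one]
    ring

/-- In the recursion, `Δ(2 x₀ c_{k+1}) = 4 (k + 2) c_k` cancels `Δ(|x|² c_k) = (8 + 4k) c_k`; the
`8` is twice the dimension. -/
theorem laplacian_chebPoly : ∀ k, laplacian (chebPoly k) = 0
  | 0 => by simp [chebPoly, laplacian]
  | 1 => by simp [chebPoly, laplacian, Fin.sum_univ_four]
  | k + 2 => by
    have h0 := laplacian_chebPoly k
    have h1 := laplacian_chebPoly (k + 1)
    have hX : laplacian (X 0 : MvPolynomial (Fin 4) ℝ) = 0 := by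
      simp [laplacian, Fin.sum_univ_four]
    have hN : laplacian (normSqPoly 4) = 8 := by
      simp only [laplacian, pderiv_normSqPoly, Derivation.map_smul, pderiv_X_self, Fin.sum_univ_four]
      simp only [smul_eq_C_mul, map_ofNat]
      ring
    have hE := (chebPoly_isHomogeneous k).sum_X_mul_pderiv
    have hsub : ∀ p q : MvPolynomial (Fin 4) ℝ,
        laplacian ((2 : ℝ) • p - q) = (2 : ℝ) • laplacian p - laplacian q := by
      intro p q
      simp only [laplacian, map_sub, Derivation.map_smul, Finset.sum_sub_distrib, Finset.smul_sum]
    have hs : ∑ i, pderiv i (X 0 : MvPolynomial (Fin 4) ℝ) * pderiv i (chebPoly (k + 1)) =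
        pderiv 0 (chebPoly (k + 1)) := by
      simp [Fin.sum_univ_four]
    rw [chebPoly, hsub, laplacian_mul, laplacian_mul, h0, h1, hX, hN, hs, pderiv_zero_chebPoly]
    simp_rw [pderiv_normSqPoly, smul_mul_assoc]
    rw [← Finset.smul_sum, hE]
    simp only [smul_eq_C_mul, nsmul_eq_mul, map_add, map_natCast, map_ofNat]
    ring

/-- On the sphere `|x|² = 1`, so the second term of the recursion has lower degree and is orthogonal
to `p`. Each step trades `c_{j+1}` for `2 x₀ c_j`; the power `x₀ ^ i` collects these factors. -/
theorem sphereInt_harmonic_mul_chebPoly {k : ℕ} {p : MvPolynomial (Fin 4) ℝ}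
    (hp : p.IsHomogeneous k) (hpl : laplacian p = 0) : ∀ j i : ℕ, i + j = k →
    sphereInt 4 (p * (X 0 ^ i * chebPoly j)) = 2 ^ j * sphereInt 4 (p * X 0 ^ k)
  | 0, i, h => by
    rw [← h]
    simp [chebPoly]
  | 1, i, h => by
    rw [← h, chebPoly, mul_smul_comm, mul_smul_comm, map_smul, ← pow_succ]
    simp
  | j + 2, i, h => by
    have h1 := sphereInt_harmonic_mul_chebPoly hp hpl (j + 1) (i + 1) (by omega)
    have h2 : sphereInt 4 (p * (X 0 ^ i * chebPoly j)) = 0 :=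
      sphereInt_harmonic_mul_eq_zero (e := 2) (i + j) k (by omega) hp hpl
        ((isHomogeneous_X_pow _ _).mul (chebPoly_isHomogeneous j))
    rw [← sphereInt_normSqPoly_mul] at h2
    have e : p * (X 0 ^ i * chebPoly (j + 2)) =
        (2 : ℝ) • (p * (X 0 ^ (i + 1) * chebPoly (j + 1))) -
          normSqPoly 4 * (p * (X 0 ^ i * chebPoly j)) := by
      rw [chebPoly]
      simp only [smul_eq_C_mul]
      ring
    rw [e, map_sub, map_smul, h1, h2, smul_eq_mul]
    ring

/-! ### Identification of the zonal harmonic -/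

theorem sphereInt_one_pos : 0 < sphereInt 4 1 := by
  rw [sphereInt_apply]
  simp only [map_one, integral_const, smul_eq_mul, mul_one]
  rw [Measure.toSphere_real_apply_univ]
  have : 0 < (volume : Measure (EuclideanSpace ℝ (Fin 4))).real (Metric.ball 0 1) :=
    ENNReal.toReal_pos (Metric.measure_ball_pos _ _ one_pos).ne' measure_ball_lt_top.ne
  have h4 : (0 : ℝ) < (Module.finrank ℝ (EuclideanSpace ℝ (Fin 4)) : ℝ) := by simp
  exact mul_pos h4 this

theorem average_eq_sphereInt (p q : MvPolynomial (Fin 4) ℝ) :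
    ⨍ ζ : Metric.sphere (0 : EuclideanSpace ℝ (Fin 4)) 1,
      eval (fun i => (ζ : EuclideanSpace ℝ (Fin 4)) i) p *
        eval (fun i => (ζ : EuclideanSpace ℝ (Fin 4)) i) q
      ∂((volume : Measure (EuclideanSpace ℝ (Fin 4))).toSphere) =
      (sphereInt 4 1)⁻¹ * sphereInt 4 (p * q) := by
  rw [average_eq, sphereInt_apply, sphereInt_apply]
  simp

theorem isZonalHarmonic_chebPoly {k : ℕ} {η : EuclideanSpace ℝ (Fin 4)}
    (hη : (fun i => η i) = pole) :
    IsZonalHarmonic k η (((k : ℝ) + 1) • chebPoly k) := by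
  refine ⟨⟨?_, ?_⟩, fun p hp => ?_⟩
  · rw [smul_eq_C_mul]
    exact (chebPoly_isHomogeneous k).C_mul _
  · have := laplacian_chebPoly k
    simp only [laplacian] at this
    simp only [Derivation.map_smul, ← Finset.smul_sum, this, smul_zero]
  · have h1 := sphereInt_harmonic_mul_chebPoly hp.1 hp.2 k 0 (zero_add k)
    have h2 := sphereInt_harmonic_mul_X_pow k hp.1 hp.2
    have h3 := sphereInt_one_pos.ne'
    rw [average_eq_sphereInt, hη, mul_smul_comm, map_smul]
    rw [pow_zero, one_mul] at h1
    rw [h1, smul_eq_mul]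
    field_simp
    linear_combination -h2

/-- Testing both reproducing properties on `Z - W` shows that it is orthogonal to itself. -/
theorem IsZonalHarmonic.unique {k : ℕ} {η : EuclideanSpace ℝ (Fin 4)}
    {Z W : MvPolynomial (Fin 4) ℝ} (hZ : IsZonalHarmonic k η Z) (hW : IsZonalHarmonic k η W) :
    Z = W := by
  have hh : IsSolidHarmonic k (Z - W) := by
    refine ⟨hZ.1.1.sub hW.1.1, ?_⟩
    simp only [map_sub, Finset.sum_sub_distrib, hZ.1.2, hW.1.2, sub_zero]
  have h1 := hZ.2 _ hh
  rw [hW.2 _ hh, average_eq_sphereInt, average_eq_sphereInt] at h1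
  have h2 := mul_left_cancel₀ (inv_ne_zero sphereInt_one_pos.ne') h1
  have h3 : sphereInt 4 ((Z - W) * (Z - W)) = 0 := by
    rw [mul_sub (Z - W), map_sub, h2, sub_self]
  exact sub_eq_zero.1 (sphereInt_eq_zero_of_mul_self hh.1 h3)

theorem zonalPoly_eq {k : ℕ} {η : EuclideanSpace ℝ (Fin 4)} (hη : (fun i => η i) = pole) :
    zonalPoly k η = ((k : ℝ) + 1) • chebPoly k := by
  have h : ∃ Z, IsZonalHarmonic k η Z := ⟨_, isZonalHarmonic_chebPoly hη⟩
  rw [zonalPoly, dif_pos h]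
  exact (Classical.choose_spec h).unique (isZonalHarmonic_chebPoly hη)

theorem zonalTilde_natCast (k : ℕ) (x : ℍ[ℝ]) :
    zonalTilde k x = eval (fun i => Quaternion.linearIsometryEquivTuple x i) (chebPoly k) := by
  have hη : (fun i => Quaternion.linearIsometryEquivTuple (1 : ℍ[ℝ]) i) = pole := by
    funext i
    fin_cases i <;> simp [pole]
  have hk : (k : ℝ) + 1 ≠ 0 := by positivity
  change zonal k x 1 / ((k : ℝ) + 1) = _
  rw [zonal, zonalPoly_eq hη, smul_eval, mul_div_cancel_left₀ _ hk]

/-- Both sides obey the recursion coming from `z² = 2 (Re z) z - |z|²`. -/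
theorem norm_im_mul_eval_chebPoly (x : ℍ[ℝ]) : ∀ k : ℕ,
    ‖x.im‖ * eval (fun i => Quaternion.linearIsometryEquivTuple x i) (chebPoly k) =
      (toC x ^ (k + 1)).im
  | 0 => by simp [chebPoly, toC]
  | 1 => by
    simp [chebPoly, toC, pow_two]
    ring
  | k + 2 => by
    have h0 := norm_im_mul_eval_chebPoly x k
    have h1 := norm_im_mul_eval_chebPoly x (k + 1)
    have hN : eval (fun i => Quaternion.linearIsometryEquivTuple x i) (normSqPoly 4) =
        x.re ^ 2 + ‖x.im‖ ^ 2 := by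
      rw [sq ‖x.im‖, ← Quaternion.normSq_eq_norm_mul_self, Quaternion.normSq_def']
      simp [normSqPoly, Fin.sum_univ_four]
      ring
    have hX : Quaternion.linearIsometryEquivTuple x 0 = x.re := rfl
    rw [chebPoly, map_sub, map_mul, smul_eval, map_mul, eval_X, hN, hX, mul_sub]
    have e1 : ‖x.im‖ * (2 * (x.re * eval (fun i => Quaternion.linearIsometryEquivTuple x i)
        (chebPoly (k + 1)))) = 2 * x.re * (toC x ^ (k + 1 + 1)).im := by
      rw [← h1]; ring
    have e2 : ‖x.im‖ * ((x.re ^ 2 + ‖x.im‖ ^ 2) * eval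
        (fun i => Quaternion.linearIsometryEquivTuple x i) (chebPoly k)) =
          (x.re ^ 2 + ‖x.im‖ ^ 2) * (toC x ^ (k + 1)).im := by
      rw [← h0]; ring
    rw [e1, e2, pow_succ _ (k + 2), pow_succ _ (k + 1)]
    simp only [Complex.mul_im, Complex.mul_re, toC]
    ring

/-- For `m = 0` the convention at index `-1` agrees with `Im (z ^ 0) = 0`. -/
theorem zonalTilde_eq (m : ℕ) {x : ℍ[ℝ]} (hx : x.im ≠ 0) :
    zonalTilde ((m : ℤ) - 1) x = ‖x.im‖⁻¹ * (toC x ^ m).im := by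
  cases m with
  | zero =>
    rw [show ((0 : ℕ) : ℤ) - 1 = Int.negSucc 0 from rfl]
    simp [zonalTilde]
  | succ k =>
    rw [Nat.cast_succ, add_sub_cancel_right, zonalTilde_natCast, ← norm_im_mul_eval_chebPoly,
      inv_mul_cancel_left₀ (norm_ne_zero_iff.2 hx)]

theorem continuous_zonalTilde : ∀ k : ℤ, Continuous (zonalTilde k)
  | Int.ofNat k => by
    have : zonalTilde (Int.ofNat k) = fun x : ℍ[ℝ] =>
        eval (fun i => Quaternion.linearIsometryEquivTuple x i) (chebPoly k) :=
      funext fun x => zonalTilde_natCast k x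
    rw [this]
    exact (continuous_eval_euclidean _).comp Quaternion.linearIsometryEquivTuple.continuous
  | Int.negSucc k => by
    have : zonalTilde (Int.negSucc k) = fun _ => 0 := rfl
    rw [this]
    exact continuous_const

end Zonal

/-! ### Continuity and the main theorem -/

theorem continuous_ordProd {X : Type*} [TopologicalSpace X] {n : ℕ} (S : Finset (Fin n))
    {q : X → Fin n → ℍ[ℝ]} (hq : ∀ i, Continuous fun x => q x i) :
    Continuous fun x => ordProd S (q x) :=
  continuous_list_prod _ fun i _ => hq i

end Almansi

end

theorem proposition4p2 (n : ℕ) (a : (Fin n → ℕ) →₀ ℍ[ℝ]) (H K : Finset (Fin n)) (hK : K ⊆ H) :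
    Almansi.IsSlice (Almansi.polyFun a) ∧
    (∀ x ∈ Almansi.offReal H,
      Almansi.component H K (Almansi.polyFun a) x =
        ∑ α ∈ a.support,
          ((∏ j ∈ H, Almansi.zonalTilde ((α j : ℤ) - 1 + (if j ∈ K then 1 else 0)) (x j) : ℝ) :
              ℍ[ℝ]) *
            Almansi.ordProd Hᶜ (fun i => x i ^ α i) * a α) ∧
    (∀ x : Fin n → ℍ[ℝ],
      Filter.Tendsto (Almansi.component H K (Almansi.polyFun a))
        (nhdsWithin x (Almansi.offReal H))
        (nhds (∑ α ∈ a.support,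
          ((∏ j ∈ H, Almansi.zonalTilde ((α j : ℤ) - 1 + (if j ∈ K then 1 else 0)) (x j) : ℝ) :
              ℍ[ℝ]) *
            Almansi.ordProd Hᶜ (fun i => x i ^ α i) * a α))) := by
  have key : ∀ x ∈ Almansi.offReal H,
      Almansi.component H K (Almansi.polyFun a) x =
        ∑ α ∈ a.support,
          ((∏ j ∈ H, Almansi.zonalTilde ((α j : ℤ) - 1 + (if j ∈ K then 1 else 0)) (x j) : ℝ) :
              ℍ[ℝ]) *
            Almansi.ordProd Hᶜ (fun i => x i ^ α i) * a α := by
    intro x hx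
    rw [Almansi.component_polyFun H K a hK]
    refine Finset.sum_congr rfl fun α _ => ?_
    congr 3
    refine Finset.prod_congr rfl fun j hj => ?_
    rw [← Almansi.zonalTilde_eq _ (hx j hj)]
    congr 1
    push_cast
    ring
  refine ⟨Almansi.isSlice_polyFun a, key, fun x => ?_⟩
  -- On `offReal H` the component equals a function continuous on all of `ℍⁿ`, whose limit is its
  -- value.
  refine Filter.Tendsto.congr' (f₁ := fun x : Fin n → ℍ[ℝ] => ∑ α ∈ a.support,
    ((∏ j ∈ H, Almansi.zonalTilde ((α j : ℤ) - 1 + (if j ∈ K then 1 else 0)) (x j) : ℝ) : ℍ[ℝ]) *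
      Almansi.ordProd Hᶜ (fun i => x i ^ α i) * a α) ?_ ?_
  · filter_upwards [self_mem_nhdsWithin] with y hy
    exact (key y hy).symm
  · refine (Continuous.tendsto ?_ x).mono_left nhdsWithin_le_nhds
    refine continuous_finsetSum _ fun α _ => ?_
    refine Continuous.mul (Continuous.mul ?_ ?_) continuous_const
    · exact Quaternion.continuous_coe.comp (continuous_finsetProd _ fun j _ =>
        (Almansi.continuous_zonalTilde _).comp (continuous_apply j))
    · exact Almansi.continuous_ordProd _ fun i => (continuous_apply i).pow _
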